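/- A hypergraph $H=(V,E)$ consists of a non-empty finite set $V$ of vertices and a finite multiset $E$ of subsets of $V$, called edges (equal edges of the multiset count as distinct edges). A walk in $H$ is an alternating sequence $v_0e_1v_1\ldots e_kv_k$ of vertices and edges such that $v_{i-1}\neq v_i$ and $v_{i-1},v_i\in e_i$ for $i=1,\ldots,k$; it is closed if $v_0=v_k$ and $k\ge 2$, and a trail if $e_1,\ldots,e_k$ are pairwise distinct. $H$ is connected if every two vertices are joined by a walk. A spanning Euler tour of $H$ is a closed trail that traverses every edge and contains every vertex of $H$. For $S\subsetneq V$, let $H\backslash S$ be the hypergraph obtained from $H$ by deleting the vertices of $S$ from $V$ and from every edge, and then deleting all empty edges; $S$ is a vertex cut of $H$ if $H\backslash S$ is disconnected. Connected components are the maximal connected subhypergraphs without empty edges, where a subhypergraph of $(V,E)$ is a hypergraph $(V',E')$ with $V'\subseteq V$ and $E'$ the multiset of the sets $e\cap V'$, $e\in E''$, for some submultiset $E''$ of $E$. For a connected component $H_i$ of $H\backslash S$, the $S$-component $H_i'$ has vertex set $V(H_i)\cup S$, and its edges are the non-empty edges of $H$ contained in $V(H_i)\cup S$; if $|S|$ is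 even, the $S^\ast$-component $H_i^\ast$ is obtained from $H_i'$ by adjoining $\frac{|S|}{2}$ further copies of the edge $S$. **Theorem.** Let $H=(V,E)$ be a hypergraph without empty edges, with a vertex cut $S=\{u,v\}$ of cardinality $2$, and assume that the number of edges of $H$ equal to $S$ (counted with multiplicity) is odd. Let $H_1,\ldots,H_k$ be the connected components of $H\backslash S$, let $H_1',\ldots,H_k'$ be the corresponding $S$-components, and let $H_1^\ast,\ldots,H_k^\ast$ be the corresponding $S^\ast$-components. Then $H$ admits a spanning Euler tour if and only if there exists a subset $J\subseteq\{1,\ldots,k\}$ of odd size such that 1. $H_i'$ admits a spanning Euler tour for each $i\in J$; and 2. $H_i^\ast$ admits a spanning Euler tour for each $i\in\{1,\ldots,k\}\setminus J$. -/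

import Mathlib

/-- A hypergraph with repeated edges allowed, on a finite non-empty vertex set; the edges form a finite multiset of
subsets of the vertex set. -/
@[ext] structure MultiHypergraph (α : Type*) where
  verts : Finset α
  nonempty : verts.Nonempty
  edges : Multiset (Finset α)
  edge_subset : ∀ e ∈ edges, e ⊆ verts

namespace MultiHypergraph

variable {α : Type*} [DecidableEq α]

/-- The edges of `H`, parallel edges being distinct: an element is a pair consisting of a vertex
subset and the number of the copy. -/
abbrev Edge (H : MultiHypergraph α) : Type _ := H.edges.ToType

/-- The vertex subset underlying an edge. -/
abbrev Edge.ends {H : MultiHypergraph α} (e : H.Edge) : Finset α := e.1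

/-- `x` and `y` are adjacent via the edge `e`. -/
def AdjVia (H : MultiHypergraph α) (e : H.Edge) (x y : α) : Prop :=
  x ≠ y ∧ x ∈ e.ends ∧ y ∈ e.ends

/-- A walk `v₀ e₁ v₁ … e_k v_k`. The edge `e_{i+1}` is `edge i`. -/
structure Walk (H : MultiHypergraph α) where
  length : ℕ
  anchor : Fin (length + 1) → α
  edge : Fin length → H.Edge
  anchor_mem : ∀ i, anchor i ∈ H.verts
  adj : ∀ i : Fin length, H.AdjVia (edge i) (anchor i.castSucc) (anchor i.succ)

namespace Walk

variable {H : MultiHypergraph α}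

/-- A closed walk: equal endpoints and length at least two. -/
def IsClosed (W : H.Walk) : Prop :=
  W.anchor 0 = W.anchor (Fin.last W.length) ∧ 2 ≤ W.length

/-- A (strict) trail: pairwise distinct edges. -/
def IsTrail (W : H.Walk) : Prop := Function.Injective W.edge

/-- An Euler tour: a closed trail traversing every edge. -/
def IsEulerTour (W : H.Walk) : Prop :=
  W.IsClosed ∧ W.IsTrail ∧ ∀ e : H.Edge, ∃ i, W.edge i = e

/-- A spanning Euler tour: every vertex is an anchor. -/
def IsSpanningEulerTour (W : H.Walk) : Prop :=
  W.IsEulerTour ∧ ∀ x ∈ H.verts, ∃ i, W.anchor i = x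

end Walk

/-- `H` admits a spanning Euler tour. -/
def HasSpanningEulerTour (H : MultiHypergraph α) : Prop :=
  ∃ W : H.Walk, W.IsSpanningEulerTour

/-- Every two vertices are joined by a walk. -/
def Connected (H : MultiHypergraph α) : Prop :=
  ∀ x ∈ H.verts, ∀ y ∈ H.verts,
    ∃ W : H.Walk, W.anchor 0 = x ∧ W.anchor (Fin.last W.length) = y

/-- `H'` is a subhypergraph of `H`: its edges are the traces on its vertex set of the edges in
some submultiset of the edges of `H`. -/
def IsSubhypergraph (H' H : MultiHypergraph α) : Prop :=
  H'.verts ⊆ H.verts ∧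
    ∃ E'' : Multiset (Finset α), E'' ≤ H.edges ∧ H'.edges = E''.map (fun e => e ∩ H'.verts)

/-- The subhypergraph obtained from `H` by deleting the vertices in `S` from the vertex set and
from every edge, and then deleting all empty edges. -/
def delete (H : MultiHypergraph α) (S : Finset α) (hS : S ⊂ H.verts) : MultiHypergraph α where
  verts := H.verts \ S
  nonempty := Finset.sdiff_nonempty.mpr hS.2
  edges := (H.edges.map (fun e => e ∩ (H.verts \ S))).filter (fun e => e ≠ ∅)
  edge_subset := by
    intro e he
    obtain ⟨f, -, rfl⟩ := Multiset.mem_map.mp (Multiset.mem_of_mem_filter he)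
    exact Finset.inter_subset_right

/-- A connected subhypergraph of `H` without empty edges. -/
def IsConnectedPiece (F H : MultiHypergraph α) : Prop :=
  F.IsSubhypergraph H ∧ F.Connected ∧ ∅ ∉ F.edges

/-- `F` is a connected component of `H`: a maximal connected subhypergraph of `H` without empty
edges. -/
def IsComponent (F H : MultiHypergraph α) : Prop :=
  F.IsConnectedPiece H ∧
    ∀ F' : MultiHypergraph α, F'.IsConnectedPiece H → F.IsSubhypergraph F' → F' = F

/-- `S` is a vertex cut: a proper subset of the vertex set whose deletion leaves a disconnected
hypergraph. -/
structure IsVertexCut (H : MultiHypergraph α) (S : Finset α) : Prop where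
  ssubset : S ⊂ H.verts
  disconnected : ¬ (H.delete S ssubset).Connected

/-- The `S`-component of `H` corresponding to a connected component `F` of `H \ S`: the vertex
set is `V(F) ∪ S`, the edges are the non-empty edges of `H` contained in it. -/
def sComponent (H : MultiHypergraph α) (S : Finset α) (F : MultiHypergraph α) : MultiHypergraph α where
  verts := F.verts ∪ S
  nonempty := F.nonempty.mono Finset.subset_union_left
  edges := H.edges.filter (fun e => e ⊆ F.verts ∪ S ∧ e ≠ ∅)
  edge_subset := fun _ he => (Multiset.mem_filter.mp he).2.1

/-- The `S*`-component of `H` corresponding to `F` (for `|S|` even): the `S`-component with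
`|S| / 2` further copies of the edge `S`. -/
def sStarComponent (H : MultiHypergraph α) (S : Finset α) (F : MultiHypergraph α) : MultiHypergraph α where
  verts := (H.sComponent S F).verts
  nonempty := (H.sComponent S F).nonempty
  edges := (H.sComponent S F).edges + Multiset.replicate (S.card / 2) S
  edge_subset := by
    intro e he
    rcases Multiset.mem_add.mp he with h | h
    · exact (H.sComponent S F).edge_subset e h
    · rw [Multiset.eq_of_mem_replicate h]
      exact Finset.subset_union_right

end MultiHypergraph

/-! A closed trail enters and leaves each edge at two distinct vertices. By Euler's theorem, a
spanning Euler tour of a hypergraph with at least two vertices therefore amounts to a choice of one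
pair of distinct vertices from every edge such that the resulting multigraph is connected with all
degrees even (`IsEulerSelection`, `HasSpanningEulerTour.exists_selection`,
`IsEulerSelection.hasSpanningEulerTour`). The theorem is then a parity count on such selections.

Let m be the odd number of edges equal to S. Each of them must choose the pair uv, so uv occurs in
every selection. An edge not contained in S lies in exactly one S-component, while the edges inside
S lie in all of them.

Given a selection for H, restrict it to an S-component. It stays connected, since a path that
reaches u or v can finish along uv. Vertices outside S keep even degree, and by the handshake lemma
u and v have degrees d_i of equal parity. If d_i is even, the restriction is a selection for H_i';
if it is odd, one additional pair uv makes it a selection for H_i*. Let J be the set of i with d_i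
even. The degree of u in H is m + ∑ (d_i - m), an even number, and d_i - m is odd exactly for i in
J, so |J| is odd (`IsEulerSelection.odd_card`).

Conversely, remove the pairs uv from the given selections. What remains has odd degree at u and v
exactly for i in J, so the union together with m pairs uv has even degrees
(`isEulerSelection_glue`). -/

namespace MultiHypergraph

/-! ### Trails, degree parity and Euler's theorem in labelled multigraphs -/

/-- `Trail a b M`: the labelled edges in the multiset `M` can be arranged as a trail from `a` to `b`. -/
inductive Trail {α β : Type*} : α → α → Multiset (β × Sym2 α) → Prop
  | nil (a : α) : Trail a a 0
  | cons {x y b : α} {M : Multiset (β × Sym2 α)} (l : β) (hne : x ≠ y) (h : Trail y b M) :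
      Trail x b ((l, s(x, y)) ::ₘ M)

/-- Adjacency of two vertices in a labelled multigraph. -/
def PairAdj {α β : Type*} (M : Multiset (β × Sym2 α)) (x y : α) : Prop := ∃ l, (l, s(x, y)) ∈ M

/-- The degree modulo two of a vertex in a labelled loopless multigraph. -/
def parity {α β : Type*} [DecidableEq α] (x : α) (M : Multiset (β × Sym2 α)) : ZMod 2 :=
  (M.map fun p => if x ∈ p.2 then 1 else 0).sum

section Multigraph

variable {α β : Type*}

theorem PairAdj.symm {M : Multiset (β × Sym2 α)} {x y : α} (h : PairAdj M x y) : PairAdj M y x := by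
  obtain ⟨l, h⟩ := h
  exact ⟨l, by rwa [Sym2.eq_swap]⟩

theorem PairAdj.reach_symm {M : Multiset (β × Sym2 α)} {x y : α}
    (h : Relation.ReflTransGen (PairAdj M) x y) : Relation.ReflTransGen (PairAdj M) y x :=
  have : Std.Symm (PairAdj M) := ⟨fun _ _ h => h.symm⟩
  Std.Symm.symm _ _ h

namespace Trail

theorem append {a b c : α} {M N : Multiset (β × Sym2 α)} (h : Trail a b M) (h' : Trail b c N) :
    Trail a c (M + N) := by
  induction h with
  | nil => simpa using h'
  | cons l hne _ ih => rw [Multiset.cons_add]; exact cons l hne (ih h')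

theorem split {a b z : α} {M : Multiset (β × Sym2 α)} (h : Trail a b M)
    (hz : ∃ p ∈ M, z ∈ p.2) :
    ∃ M₁ M₂, Trail a z M₁ ∧ Trail z b M₂ ∧ M = M₁ + M₂ := by
  induction h with
  | nil => simp at hz
  | @cons x y b M l hne h ih =>
    by_cases hx : z = x
    · subst hx
      exact ⟨0, _, nil _, cons l hne h, by simp⟩
    by_cases hy : z = y
    · subst hy
      exact ⟨{(l, s(x, z))}, M, cons l hne (nil _), h, by simp⟩
    · obtain ⟨p, hp, hzp⟩ := hz
      rcases Multiset.mem_cons.mp hp with rfl | hp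
      · simp [hx, hy] at hzp
      · obtain ⟨M₁, M₂, h₁, h₂, rfl⟩ := ih ⟨p, hp, hzp⟩
        exact ⟨_, M₂, cons l hne h₁, h₂, by simp⟩

theorem rotate {a z : α} {M : Multiset (β × Sym2 α)} (h : Trail a a M)
    (hz : ∃ p ∈ M, z ∈ p.2) : Trail z z M := by
  obtain ⟨M₁, M₂, h₁, h₂, rfl⟩ := h.split hz
  rw [add_comm]
  exact h₂.append h₁

end Trail

variable [DecidableEq α]

@[simp] theorem parity_zero (x : α) : parity x (0 : Multiset (β × Sym2 α)) = 0 := rfl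

@[simp] theorem parity_cons (x : α) (p : β × Sym2 α) (M : Multiset (β × Sym2 α)) :
    parity x (p ::ₘ M) = (if x ∈ p.2 then 1 else 0) + parity x M := by
  simp [parity]

@[simp] theorem parity_add (x : α) (M N : Multiset (β × Sym2 α)) :
    parity x (M + N) = parity x M + parity x N := by
  simp [parity]

theorem parity_sum {ι : Type*} (x : α) (s : Finset ι) (M : ι → Multiset (β × Sym2 α)) :
    parity x (∑ i ∈ s, M i) = ∑ i ∈ s, parity x (M i) := by
  classical
  induction s using Finset.induction_on with
  | empty => simp
  | insert i s hi ih => rw [Finset.sum_insert hi, Finset.sum_insert hi, parity_add, ih]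

theorem parity_replicate (x : α) (n : ℕ) (p : β × Sym2 α) :
    parity x (Multiset.replicate n p) = n * (if x ∈ p.2 then 1 else 0) := by
  simp [parity]

theorem parity_eq_zero_of_forall {x : α} {M : Multiset (β × Sym2 α)} (h : ∀ p ∈ M, x ∉ p.2) :
    parity x M = 0 := by
  induction M using Multiset.induction_on with
  | empty => rfl
  | cons p M ih =>
    rw [parity_cons, if_neg (h p (by simp)), ih (fun q hq => h q (by simp [hq])), add_zero]

theorem exists_mem_of_parity_ne_zero {x : α} {M : Multiset (β × Sym2 α)} (h : parity x M ≠ 0) :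
    ∃ p ∈ M, x ∈ p.2 := by
  by_contra! hc
  exact h (parity_eq_zero_of_forall hc)

theorem parity_filter_add (x : α) (M : Multiset (β × Sym2 α)) (q : β × Sym2 α → Prop)
    [DecidablePred q] :
    parity x (M.filter q) + parity x (M.filter fun p => ¬ q p) = parity x M := by
  rw [← parity_add, Multiset.filter_add_not]

/-- The handshake lemma modulo two. -/
theorem sum_parity_eq_zero (s : Finset α) (M : Multiset (β × Sym2 α))
    (h : ∀ p ∈ M, ¬ p.2.IsDiag ∧ ∀ x ∈ p.2, x ∈ s) : ∑ x ∈ s, parity x M = 0 := by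
  induction M using Multiset.induction_on with
  | empty => simp
  | cons p M ih =>
    simp only [parity_cons, Finset.sum_add_distrib]
    rw [ih fun q hq => h q (by simp [hq]), add_zero]
    obtain ⟨l, p⟩ := p
    obtain ⟨hd, hs⟩ := h _ (Multiset.mem_cons_self _ _)
    induction p using Sym2.ind with
    | _ a b =>
      have hab : a ≠ b := by simpa using hd
      have ha : a ∈ s := hs a (by simp)
      have hb : b ∈ s := hs b (by simp)
      have : ∀ x ∈ s, (if x ∈ s(a, b) then (1 : ZMod 2) else 0)
          = (if x = a then 1 else 0) + (if x = b then 1 else 0) := by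
        intro x _
        by_cases h1 : x = a <;> by_cases h2 : x = b <;> simp_all
      rw [Finset.sum_congr rfl this, Finset.sum_add_distrib]
      simp only [Finset.sum_ite_eq', ha, hb, if_true]
      decide

theorem Trail.parity_eq {a b : α} {M : Multiset (β × Sym2 α)} (h : Trail a b M) (x : α) :
    parity x M = (if x = a then 1 else 0) + (if x = b then 1 else 0) := by
  have two : (1 : ZMod 2) + 1 = 0 := by decide
  induction h with
  | nil a => by_cases hx : x = a <;> simp [hx, two]
  | @cons y z b M l hne _ ih =>
    rw [parity_cons, ih]
    by_cases h1 : x = y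
    · subst h1; simp [hne]
    · by_cases h2 : x = z
      · subst h2; simp [h1, ← add_assoc, two]
      · simp [h1, h2]

/-- Euler's theorem: a connected loopless multigraph with even degrees is a closed trail. -/
theorem exists_closed_trail (V : Finset α) (hV : V.Nonempty) (P : Multiset (β × Sym2 α))
    (hP : ∀ p ∈ P, ¬ p.2.IsDiag ∧ ∀ x ∈ p.2, x ∈ V) (heven : ∀ x, parity x P = 0)
    (hconn : ∀ x ∈ V, ∀ y ∈ V, Relation.ReflTransGen (PairAdj P) x y) :
    ∃ a, Trail a a P := by
  classical
  obtain ⟨a₀, ha₀⟩ := hV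
  -- Take a trail of maximal length; its start is kept in `V` so that `hconn` applies to it.
  let Q : ℕ → Prop := fun n => ∃ a ∈ V, ∃ b, ∃ M ≤ P, Trail a b M ∧ M.card = n
  have hQ0 : Q 0 := ⟨a₀, ha₀, a₀, 0, Multiset.zero_le _, .nil _, rfl⟩
  have hQb : ∀ n, Q n → n ≤ P.card := by
    rintro n ⟨_, _, _, M, hM, _, rfl⟩
    exact Multiset.card_le_card hM
  have hspec := Nat.findGreatest_spec (P := Q) (Nat.zero_le P.card) hQ0
  obtain ⟨a, haV, b, M, hMP, hM, hcard⟩ := hspec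
  -- Maximality concerns the multiset `M` alone, so it also bars extending any rearrangement of `M`
  -- into another trail.
  have key : ∀ l x y c, (l, s(x, y)) ∈ P - M → Trail y c M → False := by
    intro l x y c hl ht
    have hlP := hP _ (Multiset.mem_of_le (Multiset.sub_le_self _ _) hl)
    have hle : (l, s(x, y)) ::ₘ M ≤ P := by
      calc (l, s(x, y)) ::ₘ M = {(l, s(x, y))} + M := (Multiset.singleton_add _ _).symm
        _ ≤ (P - M) + M := by gcongr; exact Multiset.singleton_le.mpr hl
        _ = P := Multiset.sub_add_cancel hMP
    have hq : Q (M.card + 1) :=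
      ⟨x, hlP.2 x (by simp), c, _, hle, .cons l (by simpa using hlP.1) ht, by simp⟩
    have := Nat.le_findGreatest (hQb _ hq) hq
    omega
  have hsub : ∀ p ∈ P, p ∈ M ∨ p ∈ P - M := by
    intro p hp
    rw [← Multiset.mem_add, add_comm, Multiset.sub_add_cancel hMP]
    exact hp
  -- Were the ends distinct, `a` would have odd degree in `M`, hence in `P - M`, and an unused edge
  -- at `a` would prolong the trail.
  have hclosed : a = b := by
    by_contra hab
    have h1 := hM.parity_eq a
    have h2 : parity a (P - M) + parity a M = 0 := by
      rw [← parity_add, Multiset.sub_add_cancel hMP, heven]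
    have h3 : parity a (P - M) ≠ 0 := by
      intro h0
      rw [h0, h1] at h2
      simp [hab] at h2
    obtain ⟨⟨l, p⟩, hp, hap⟩ := exists_mem_of_parity_ne_zero h3
    obtain ⟨x, rfl⟩ := hap
    exact key l x a b (by rwa [Sym2.eq_swap]) hM
  subst hclosed
  -- Connectivity carries the base point from vertex to vertex: an edge of `M` permits a rotation,
  -- and an unused edge contradicts maximality. Any leftover edge could then be attached.
  have hall : ∀ y ∈ V, Trail y y M := by
    intro y hy
    have := hconn a haV y hy
    induction this with
    | refl => exact hM
    | @tail c d _ hcd ih =>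
      obtain ⟨l, hl⟩ := hcd
      have hc := (hP _ hl).2 c (by simp)
      rcases hsub _ hl with h | h
      · exact (ih hc).rotate ⟨_, h, by simp⟩
      · exact (key l d c c (by rwa [Sym2.eq_swap]) (ih hc)).elim
  refine ⟨a, ?_⟩
  have hzero : P - M = 0 := by
    refine Multiset.eq_zero_of_forall_notMem ?_
    rintro ⟨l, p⟩ hp
    have hpP := hP _ (Multiset.mem_of_le (Multiset.sub_le_self _ _) hp)
    induction p using Sym2.ind with
    | _ x y => exact key l x y y hp (hall y (hpP.2 y (by simp)))
  have : M = P := by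
    have h := Multiset.sub_add_cancel hMP
    rwa [hzero, zero_add] at h
  rwa [this] at hM

end Multigraph

/-! ### Spanning Euler tours as Euler selections -/

section Conversion

variable {α β : Type*}

theorem trail_of_sequence {n : ℕ} (v : Fin (n + 1) → α) (l : Fin n → β)
    (hne : ∀ i : Fin n, v i.castSucc ≠ v i.succ) :
    Trail (v 0) (v (Fin.last n))
      ((Finset.univ : Finset (Fin n)).val.map fun i => (l i, s(v i.castSucc, v i.succ))) := by
  induction n with
  | zero => exact .nil _
  | succ n ih =>
    have h := ih (fun i => v i.succ) (fun i => l i.succ) (fun i => by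
      exact hne i.succ)
    have h2 := Trail.cons (l 0) (hne 0) h
    rw [Fin.univ_succ]
    simpa [Function.comp_def] using h2

theorem Trail.exists_sequence {a b : α} {M : Multiset (β × Sym2 α)} (h : Trail a b M) :
    ∃ (n : ℕ) (v : Fin (n + 1) → α) (l : Fin n → β), v 0 = a ∧ v (Fin.last n) = b ∧
      (∀ i : Fin n, v i.castSucc ≠ v i.succ) ∧
      (Finset.univ : Finset (Fin n)).val.map (fun i => (l i, s(v i.castSucc, v i.succ))) = M := by
  induction h with
  | nil a => exact ⟨0, fun _ => a, Fin.elim0, rfl, rfl, fun i => i.elim0, rfl⟩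
  | @cons x y b M k hne _ ih =>
    obtain ⟨n, v, l, rfl, rfl, h3, rfl⟩ := ih
    refine ⟨n + 1, Fin.cons x v, Fin.cons k l, rfl, ?_, ?_, ?_⟩
    · rw [← Fin.succ_last, Fin.cons_succ]
    · intro i
      refine Fin.cases ?_ (fun i => ?_) i
      · simpa using hne
      · simpa [← Fin.succ_castSucc] using h3 i
    · rw [Fin.univ_succ]
      simp [Function.comp_def]

/-- Equal multisets of values have fibres of equal size. This assigns to the positions of a trail
distinct copies of parallel edges. -/
theorem exists_equiv_of_map_univ_eq {A B X : Type*} [Fintype A] [Fintype B] (f : A → X) (g : B → X)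
    (h : (Finset.univ : Finset A).val.map f = (Finset.univ : Finset B).val.map g) :
    ∃ e : A ≃ B, ∀ a, g (e a) = f a := by
  classical
  have hfib : ∀ x, Fintype.card {a // f a = x} = Fintype.card {b // g b = x} := by
    intro x
    have hx := congrArg (Multiset.count x) h
    simp only [Multiset.count_map] at hx
    rw [Fintype.card_subtype, Fintype.card_subtype]
    simp only [eq_comm (a := x)] at hx
    exact hx
  refine ⟨(Equiv.sigmaFiberEquiv f).symm.trans ((Equiv.sigmaCongrRight fun x =>
    Fintype.equivOfCardEq (hfib x)).trans (Equiv.sigmaFiberEquiv g)), fun a => ?_⟩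
  exact (Fintype.equivOfCardEq (hfib (f a)) ⟨a, rfl⟩).2

end Conversion

variable {α : Type*} [DecidableEq α]

/-- `P` chooses a pair of distinct vertices from every edge of `H` so that the resulting multigraph
on the vertex set of `H` is connected with even degrees. -/
structure IsEulerSelection (H : MultiHypergraph α) (P : Multiset (Finset α × Sym2 α)) : Prop where
  map_fst : P.map Prod.fst = H.edges
  not_isDiag : ∀ p ∈ P, ¬ p.2.IsDiag
  mem_edge : ∀ p ∈ P, ∀ x ∈ p.2, x ∈ p.1
  parity_eq : ∀ x, parity x P = 0
  reach : ∀ x ∈ H.verts, ∀ y ∈ H.verts, Relation.ReflTransGen (PairAdj P) x y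

theorem HasSpanningEulerTour.exists_selection {H : MultiHypergraph α}
    (h : H.HasSpanningEulerTour) : ∃ P, H.IsEulerSelection P := by
  obtain ⟨W, ⟨⟨hclosed, -⟩, htrail, hall⟩, hspan⟩ := h
  have ht := trail_of_sequence W.anchor (fun i => (W.edge i).ends) (fun i => (W.adj i).1)
  set P := (Finset.univ : Finset (Fin W.length)).val.map
    fun i => ((W.edge i).ends, s(W.anchor i.castSucc, W.anchor i.succ)) with hPdef
  have h0 : ∀ i, Relation.ReflTransGen (PairAdj P) (W.anchor 0) (W.anchor i) := by
    intro i
    induction i using Fin.induction with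
    | zero => exact .refl
    | succ i ih => exact ih.tail ⟨(W.edge i).ends, Multiset.mem_map.mpr ⟨i, by simp, rfl⟩⟩
  refine ⟨P, ?_, ?_, ?_, ?_, ?_⟩
  · rw [hPdef, Multiset.map_map]
    have hb : Function.Bijective W.edge := ⟨htrail, hall⟩
    have := congrArg Finset.val (Finset.map_univ_equiv (Equiv.ofBijective _ hb))
    rw [Finset.map_val] at this
    conv_rhs => rw [← Multiset.map_univ_coe H.edges]
    rw [← this, Multiset.map_map]
    rfl
  · intro p hp
    obtain ⟨i, -, rfl⟩ := Multiset.mem_map.mp hp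
    simpa using (W.adj i).1
  · intro p hp
    obtain ⟨i, -, rfl⟩ := Multiset.mem_map.mp hp
    intro x hx
    rcases Sym2.mem_iff.mp hx with rfl | rfl
    · exact (W.adj i).2.1
    · exact (W.adj i).2.2
  · intro x
    rw [ht.parity_eq, hclosed]
    split_ifs <;> decide
  · intro x hx y hy
    obtain ⟨i, rfl⟩ := hspan x hx
    obtain ⟨j, rfl⟩ := hspan y hy
    exact (PairAdj.reach_symm (h0 i)).trans (h0 j)

/-- A second vertex forces every vertex onto some chosen pair, so the closed trail given by Euler's
theorem spans. On a single vertex the trail could be empty, which is not a closed walk. -/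
theorem IsEulerSelection.hasSpanningEulerTour {H : MultiHypergraph α}
    {P : Multiset (Finset α × Sym2 α)} (hP : H.IsEulerSelection P) (hV : H.verts.Nontrivial) :
    H.HasSpanningEulerTour := by
  have hedge : ∀ p ∈ P, p.1 ∈ H.edges := fun p hp => by
    rw [← hP.map_fst]; exact Multiset.mem_map_of_mem _ hp
  have hmem : ∀ p ∈ P, ∀ x ∈ p.2, x ∈ H.verts := fun p hp x hx =>
    H.edge_subset _ (hedge p hp) (hP.mem_edge p hp x hx)
  obtain ⟨a, ha⟩ := exists_closed_trail H.verts H.nonempty P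
    (fun p hp => ⟨hP.not_isDiag p hp, hmem p hp⟩) hP.parity_eq hP.reach
  obtain ⟨n, v, l, h0, hlast, hne, hmap⟩ := ha.exists_sequence
  have hin : ∀ i : Fin n, (l i, s(v i.castSucc, v i.succ)) ∈ P := fun i => by
    rw [← hmap]; exact Multiset.mem_map.mpr ⟨i, by simp, rfl⟩
  have hspan : ∀ x ∈ H.verts, ∃ i : Fin n, v i.castSucc = x ∨ v i.succ = x := by
    intro x hx
    obtain ⟨y, hy, hyx⟩ := hV.exists_ne x
    rcases Relation.ReflTransGen.cases_head (hP.reach x hx y hy) with h | ⟨z, ⟨k, hk⟩, -⟩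
    · exact (hyx h.symm).elim
    · rw [← hmap] at hk
      obtain ⟨i, -, hi⟩ := Multiset.mem_map.mp hk
      have hx' : x ∈ s(v i.castSucc, v i.succ) := by
        rw [show s(v i.castSucc, v i.succ) = s(x, z) from congrArg Prod.snd hi]; simp
      exact ⟨i, by rcases Sym2.mem_iff.mp hx' with h | h <;> simp [h]⟩
  have hn : 2 ≤ n := by
    obtain ⟨x, hx⟩ := H.nonempty
    obtain ⟨i, -⟩ := hspan x hx
    match n, v, l, h0, hlast, hne, i with
    -- Length 0 is excluded by the index `i`, and a closed trail of length 1 would be a loop.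
    | 1, v, _, h0, hlast, hne, _ => exact (hne 0 (h0.trans hlast.symm)).elim
    | n + 2, _, _, _, _, _, _ => omega
  obtain ⟨e, he⟩ := exists_equiv_of_map_univ_eq l (fun x : H.Edge => x.1) (by
    rw [Multiset.map_univ_coe, ← hP.map_fst, ← hmap, Multiset.map_map]; rfl)
  let W : H.Walk :=
    { length := n
      anchor := v
      edge := e
      anchor_mem := by
        intro i
        refine Fin.cases ?_ (fun i => hmem _ (hin i) _ (by simp)) i
        have := hmem _ (hin ⟨0, by omega⟩) (v 0) (Sym2.mem_mk_left _ _)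
        exact this
      adj := fun i => by
        refine ⟨hne i, ?_, ?_⟩
        · change _ ∈ (e i).1
          rw [he]; exact hP.mem_edge _ (hin i) _ (by simp)
        · change _ ∈ (e i).1
          rw [he]; exact hP.mem_edge _ (hin i) _ (by simp) }
  refine ⟨W, ⟨⟨h0.trans hlast.symm, hn⟩, e.injective, fun x => ⟨e.symm x, e.apply_symm_apply x⟩⟩,
    fun x hx => ?_⟩
  obtain ⟨i, h | h⟩ := hspan x hx
  · exact ⟨_, h⟩
  · exact ⟨_, h⟩

end MultiHypergraph

/-! ### Connected components as reachability classes -/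

namespace MultiHypergraph

variable {α : Type*}

/-- Two vertices lie in a common edge. -/
def Link (H : MultiHypergraph α) (x y : α) : Prop := ∃ e ∈ H.edges, x ∈ e ∧ y ∈ e

theorem Link.symm {H : MultiHypergraph α} {x y : α} (h : H.Link x y) : H.Link y x := by
  obtain ⟨e, he, hx, hy⟩ := h
  exact ⟨e, he, hy, hx⟩

theorem Link.reach_symm {H : MultiHypergraph α} {x y : α}
    (h : Relation.ReflTransGen H.Link x y) : Relation.ReflTransGen H.Link y x :=
  have : Std.Symm H.Link := ⟨fun _ _ h => h.symm⟩
  Std.Symm.symm _ _ h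

variable [DecidableEq α]

theorem Walk.reach {H : MultiHypergraph α} (W : H.Walk) (i : Fin (W.length + 1)) :
    Relation.ReflTransGen H.Link (W.anchor 0) (W.anchor i) := by
  induction i using Fin.induction with
  | zero => exact .refl
  | succ i ih => exact ih.tail ⟨(W.edge i).1, Multiset.coe_mem, (W.adj i).2.1, (W.adj i).2.2⟩

theorem exists_walk_of_reach {H : MultiHypergraph α} {x y : α} (hy : y ∈ H.verts)
    (h : Relation.ReflTransGen H.Link x y) :
    ∃ W : H.Walk, W.anchor 0 = x ∧ W.anchor (Fin.last W.length) = y := by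
  induction h using Relation.ReflTransGen.head_induction_on with
  | refl =>
    exact ⟨⟨0, fun _ => y, Fin.elim0, fun _ => hy, fun i => i.elim0⟩, rfl, rfl⟩
  | @head a c hac _ ih =>
    obtain ⟨W, h0, h1⟩ := ih
    -- `Link` relates a vertex of an edge to itself, whereas a walk may not stand still; such steps
    -- are dropped.
    by_cases hne : a = c
    · exact ⟨W, h0.trans hne.symm, h1⟩
    obtain ⟨e, he, ha, hc⟩ := hac
    refine ⟨⟨W.length + 1, Fin.cons a W.anchor,
      Fin.cons ⟨e, ⟨0, Multiset.count_pos.mpr he⟩⟩ W.edge, ?_, ?_⟩, ?_, ?_⟩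
    · intro i
      exact Fin.cases (H.edge_subset e he ha) (fun i => W.anchor_mem i) i
    · intro i
      refine Fin.cases ?_ (fun i => W.adj i) i
      refine ⟨?_, ha, ?_⟩
      · change a ≠ W.anchor 0
        rwa [h0]
      · change W.anchor 0 ∈ e
        rwa [h0]
    · rfl
    · exact h1

theorem connected_iff {H : MultiHypergraph α} :
    H.Connected ↔ ∀ x ∈ H.verts, ∀ y ∈ H.verts, Relation.ReflTransGen H.Link x y := by
  refine ⟨fun h x hx y hy => ?_, fun h x hx y hy => exists_walk_of_reach hy (h x hx y hy)⟩
  obtain ⟨W, rfl, rfl⟩ := h x hx y hy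
  exact W.reach _

open Classical in
/-- The subhypergraph of `H` induced by the set of vertices reachable from `x`. -/
noncomputable def compAt (H : MultiHypergraph α) (x : α) (hx : x ∈ H.verts) :
    MultiHypergraph α where
  verts := H.verts.filter fun y => Relation.ReflTransGen H.Link x y
  nonempty := ⟨x, by simp [hx, Relation.ReflTransGen.refl]⟩
  edges := H.edges.filter fun e => e ⊆ H.verts.filter fun y => Relation.ReflTransGen H.Link x y
  edge_subset := fun _ he => (Multiset.mem_filter.mp he).2

theorem mem_compAt {H : MultiHypergraph α} {x y : α} {hx : x ∈ H.verts} :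
    y ∈ (H.compAt x hx).verts ↔ y ∈ H.verts ∧ Relation.ReflTransGen H.Link x y := by
  simp [compAt]

theorem mem_edges_compAt {H : MultiHypergraph α} {x : α} {hx : x ∈ H.verts} {e : Finset α} :
    e ∈ (H.compAt x hx).edges ↔ e ∈ H.edges ∧ e ⊆ (H.compAt x hx).verts := by
  simp [compAt]

theorem self_mem_compAt {H : MultiHypergraph α} {x : α} (hx : x ∈ H.verts) :
    x ∈ (H.compAt x hx).verts := mem_compAt.mpr ⟨hx, .refl⟩

theorem subset_compAt {H : MultiHypergraph α} {x y : α} {hx : x ∈ H.verts} {e : Finset α}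
    (he : e ∈ H.edges) (hye : y ∈ e) (hy : y ∈ (H.compAt x hx).verts) :
    e ⊆ (H.compAt x hx).verts := fun _ hz =>
  mem_compAt.mpr ⟨H.edge_subset e he hz, (mem_compAt.mp hy).2.tail ⟨e, he, hye, hz⟩⟩

theorem IsSubhypergraph.link {F H : MultiHypergraph α} (h : F.IsSubhypergraph H) {x y : α}
    (hl : F.Link x y) : H.Link x y := by
  obtain ⟨-, E, hE, hF⟩ := h
  obtain ⟨e, he, hx, hy⟩ := hl
  rw [hF] at he
  obtain ⟨f, hf, rfl⟩ := Multiset.mem_map.mp he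
  exact ⟨f, Multiset.mem_of_le hE hf, Finset.mem_of_mem_inter_left hx,
    Finset.mem_of_mem_inter_left hy⟩

theorem map_inter_verts {F : MultiHypergraph α} {E : Multiset (Finset α)} (h : E ≤ F.edges) :
    E.map (fun e => e ∩ F.verts) = E := by
  conv_rhs => rw [← Multiset.map_id E]
  exact Multiset.map_congr rfl fun e he =>
    Finset.inter_eq_left.mpr (F.edge_subset e (Multiset.mem_of_le h he))

/-- Every trace forming an edge of `F` is non-empty, so the full edge meets the reachability class
and hence lies inside it. This yields the maximality of `compAt`. -/
theorem IsConnectedPiece.isSubhypergraph_compAt {F H : MultiHypergraph α}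
    (h : F.IsConnectedPiece H) {x : α} (hx : x ∈ H.verts) {y : α} (hyF : y ∈ F.verts)
    (hy : y ∈ (H.compAt x hx).verts) : F.IsSubhypergraph (H.compAt x hx) := by
  obtain ⟨hsub, hconn, hne⟩ := h
  have hV : F.verts ⊆ (H.compAt x hx).verts := fun z hz =>
    mem_compAt.mpr ⟨hsub.1 hz, (mem_compAt.mp hy).2.trans
      (Relation.ReflTransGen.mono (fun _ _ => hsub.link) _ _ (connected_iff.mp hconn y hyF z hz))⟩
  obtain ⟨-, E, hE, hF⟩ := hsub
  refine ⟨hV, E, ?_, hF⟩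
  refine Multiset.le_filter.mpr ⟨hE, fun e he => ?_⟩
  have hmem : e ∩ F.verts ∈ F.edges := by
    rw [hF]; exact Multiset.mem_map_of_mem (fun e => e ∩ F.verts) he
  have hnonempty : (e ∩ F.verts).Nonempty := by
    rw [Finset.nonempty_iff_ne_empty]
    rintro h0
    exact hne (h0 ▸ hmem)
  obtain ⟨z, hz⟩ := hnonempty
  rw [Finset.mem_inter] at hz
  exact subset_compAt (Multiset.mem_of_le hE he) hz.1 (hV hz.2)

theorem compAt_isConnectedPiece {H : MultiHypergraph α} (hH : ∅ ∉ H.edges) {x : α}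
    (hx : x ∈ H.verts) : (H.compAt x hx).IsConnectedPiece H := by
  refine ⟨⟨fun y hy => (mem_compAt.mp hy).1, (H.compAt x hx).edges, Multiset.filter_le _ _,
    (map_inter_verts le_rfl).symm⟩, ?_, fun h => hH (mem_edges_compAt.mp h).1⟩
  have key : ∀ y, Relation.ReflTransGen H.Link x y →
      Relation.ReflTransGen (H.compAt x hx).Link x y := by
    intro y hy
    induction hy with
    | refl => exact .refl
    | @tail b c hb hbc ih =>
      obtain ⟨e, he, hbe, hce⟩ := hbc
      exact ih.tail ⟨e, mem_edges_compAt.mpr ⟨he, subset_compAt he hbe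
        (mem_compAt.mpr ⟨H.edge_subset e he hbe, hb⟩)⟩, hbe, hce⟩
  rw [connected_iff]
  intro y hy z hz
  exact (Link.reach_symm (key y (mem_compAt.mp hy).2)).trans (key z (mem_compAt.mp hz).2)

/-- Once the vertex sets agree, taking traces changes nothing, and the edge multisets bound each
other. -/
theorem IsSubhypergraph.antisymm {F G : MultiHypergraph α} (h : F.IsSubhypergraph G)
    (h' : G.IsSubhypergraph F) : F = G := by
  have hV : F.verts = G.verts := h.1.antisymm h'.1
  have aux : ∀ {A B : MultiHypergraph α}, A.IsSubhypergraph B → A.verts = B.verts →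
      A.edges ≤ B.edges := by
    rintro A B ⟨-, E, hE, hA⟩ hAB
    rw [hAB, map_inter_verts hE] at hA
    rwa [hA]
  exact MultiHypergraph.ext hV (le_antisymm (aux h hV) (aux h' hV.symm))

theorem compAt_isComponent {H : MultiHypergraph α} (hH : ∅ ∉ H.edges) {x : α}
    (hx : x ∈ H.verts) : (H.compAt x hx).IsComponent H :=
  ⟨compAt_isConnectedPiece hH hx, fun _ hF hle =>
    (hF.isSubhypergraph_compAt hx (hle.1 (self_mem_compAt hx)) (self_mem_compAt hx)).antisymm hle⟩

theorem IsComponent.eq_compAt {F H : MultiHypergraph α} (hH : ∅ ∉ H.edges) (hF : F.IsComponent H)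
    {x : α} (hxF : x ∈ F.verts) : F = H.compAt x (hF.1.1.1 hxF) :=
  (hF.2 _ (compAt_isConnectedPiece hH _)
    (hF.1.isSubhypergraph_compAt _ hxF (self_mem_compAt _))).symm

theorem IsComponent.subset {F H : MultiHypergraph α} (hH : ∅ ∉ H.edges) (hF : F.IsComponent H)
    {x : α} (hxF : x ∈ F.verts) {e : Finset α} (he : e ∈ H.edges) (hxe : x ∈ e) :
    e ⊆ F.verts := by
  rw [hF.eq_compAt hH hxF]
  exact subset_compAt he hxe (self_mem_compAt _)

theorem IsComponent.eq_of_mem {F G H : MultiHypergraph α} (hH : ∅ ∉ H.edges)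
    (hF : F.IsComponent H) (hG : G.IsComponent H) {x : α} (hxF : x ∈ F.verts)
    (hxG : x ∈ G.verts) : F = G := by
  rw [hF.eq_compAt hH hxF, hG.eq_compAt hH hxG]

theorem exists_finset_components {H : MultiHypergraph α} (hH : ∅ ∉ H.edges) :
    ∃ C : Finset (MultiHypergraph α), ∀ F, F ∈ C ↔ F.IsComponent H := by
  classical
  refine ⟨H.verts.attach.image fun x => H.compAt x.1 x.2, fun F => ⟨?_, fun hF => ?_⟩⟩
  · intro h
    obtain ⟨x, -, rfl⟩ := Finset.mem_image.mp h
    exact compAt_isComponent hH x.2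
  · obtain ⟨x, hx⟩ := F.nonempty
    exact Finset.mem_image.mpr ⟨⟨x, hF.1.1.1 hx⟩, Finset.mem_attach _ _, (hF.eq_compAt hH hx).symm⟩

end MultiHypergraph

/-! ### Distribution of the edges among the S-components -/

namespace MultiHypergraph

section Multisets

variable {β ι : Type*}

theorem sum_filter_eq_of_existsUnique (M : Multiset β) (s : Finset ι) (q : ι → β → Prop)
    [∀ i, DecidablePred (q i)] (h : ∀ b ∈ M, ∃! i, i ∈ s ∧ q i b) :
    ∑ i ∈ s, M.filter (q i) = M := by
  classical
  ext b
  rw [Multiset.count_sum']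
  simp only [Multiset.count_filter]
  by_cases hb : b ∈ M
  · obtain ⟨i, ⟨hi, hq⟩, huniq⟩ := h b hb
    rw [Finset.sum_eq_single i, if_pos hq]
    · intro j hj hji
      exact if_neg fun hqj => hji (huniq j ⟨hj, hqj⟩)
    · exact fun hni => (hni hi).elim
  · simp [Multiset.count_eq_zero_of_notMem hb]

end Multisets

variable {α : Type*} [DecidableEq α]

/-- Two distinct vertices inside {u, v} must be u and v, so the edge is all of {u, v} and its chosen
pair is forced. -/
theorem filter_subset_pair_eq_replicate {u v : α} {P : Multiset (Finset α × Sym2 α)}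
    (hd : ∀ p ∈ P, ¬ p.2.IsDiag) (hm : ∀ p ∈ P, ∀ x ∈ p.2, x ∈ p.1) :
    P.filter (fun p => p.1 ⊆ {u, v}) =
      Multiset.replicate ((P.map Prod.fst).count {u, v}) ({u, v}, s(u, v)) := by
  have key : ∀ p ∈ P, p.1 ⊆ {u, v} → p = ({u, v}, s(u, v)) := by
    rintro ⟨e, p⟩ hp he
    induction p using Sym2.ind with
    | _ a b =>
      have hab : a ≠ b := by simpa using hd _ hp
      have ha : a ∈ e := hm _ hp a (by simp)
      have hb : b ∈ e := hm _ hp b (by simp)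
      have ha' := he ha
      have hb' := he hb
      simp only [Finset.mem_insert, Finset.mem_singleton] at ha' hb'
      have hpair : s(a, b) = s(u, v) := by
        rcases ha' with rfl | rfl <;> rcases hb' with rfl | rfl
        · exact (hab rfl).elim
        · rfl
        · exact Sym2.eq_swap
        · exact (hab rfl).elim
      have hsub : ({u, v} : Finset α) ⊆ e := by
        intro x hx
        have hx : x ∈ s(u, v) := by simpa using hx
        rw [← hpair] at hx
        rcases Sym2.mem_iff.mp hx with rfl | rfl
        · exact ha
        · exact hb
      exact Prod.ext (he.antisymm hsub) hpair
  rw [Multiset.eq_replicate]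
  refine ⟨?_, fun p hp => key p (Multiset.mem_of_mem_filter hp) (Multiset.mem_filter.mp hp).2⟩
  rw [Multiset.count_map]
  congr 1
  refine Multiset.filter_congr fun p hp => ⟨fun h => by rw [key p hp h], fun h => ?_⟩
  exact h ▸ subset_rfl

section Deletion

variable {H : MultiHypergraph α} {S : Finset α} {hS : S ⊂ H.verts}

theorem empty_notMem_delete : ∅ ∉ (H.delete S hS).edges := fun h =>
  (Multiset.mem_filter.mp h).2 rfl

theorem inter_mem_delete {e : Finset α} (he : e ∈ H.edges) {x : α} (hx : x ∈ e) (hxS : x ∉ S) :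
    e ∩ (H.verts \ S) ∈ (H.delete S hS).edges := by
  refine Multiset.mem_filter.mpr ⟨Multiset.mem_map_of_mem (fun e => e ∩ (H.verts \ S)) he, ?_⟩
  refine Finset.nonempty_iff_ne_empty.mp ⟨x, ?_⟩
  simp [hx, hxS, H.edge_subset e he hx]

theorem exists_component_mem {x : α} (hx : x ∈ H.verts) (hxS : x ∉ S) :
    ∃ F : MultiHypergraph α, F.IsComponent (H.delete S hS) ∧ x ∈ F.verts := by
  have hx' : x ∈ (H.delete S hS).verts := Finset.mem_sdiff.mpr ⟨hx, hxS⟩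
  exact ⟨_, compAt_isComponent empty_notMem_delete hx', self_mem_compAt hx'⟩

namespace IsComponent

variable {F G : MultiHypergraph α}

theorem mem_of_delete (hF : F.IsComponent (H.delete S hS)) {x : α} (hx : x ∈ F.verts) :
    x ∈ H.verts ∧ x ∉ S := Finset.mem_sdiff.mp (hF.1.1.1 hx)

theorem union_subset (hF : F.IsComponent (H.delete S hS)) : F.verts ∪ S ⊆ H.verts :=
  Finset.union_subset (fun _ hx => (hF.mem_of_delete hx).1) hS.1

theorem subset_union_of_mem (hF : F.IsComponent (H.delete S hS)) {e : Finset α}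
    (he : e ∈ H.edges) {x : α} (hxe : x ∈ e) (hx : x ∈ F.verts) : e ⊆ F.verts ∪ S := by
  have hxH := hF.mem_of_delete hx
  have h := hF.subset empty_notMem_delete hx (inter_mem_delete he hxe hxH.2) (by simp [hxe, hxH])
  intro y hy
  by_cases hyS : y ∈ S
  · exact Finset.mem_union_right _ hyS
  · exact Finset.mem_union_left _ (h (by simp [hy, hyS, H.edge_subset e he hy]))

end IsComponent

/-- Any vertex of `e` outside `S` determines the component. -/
theorem existsUnique_component {C : Finset (MultiHypergraph α)}
    (hC : ∀ F, F ∈ C ↔ F.IsComponent (H.delete S hS)) {e : Finset α} (he : e ∈ H.edges)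
    (heS : ¬ e ⊆ S) : ∃! F, F ∈ C ∧ e ⊆ F.verts ∪ S := by
  obtain ⟨x, hxe, hxS⟩ := Finset.not_subset.mp heS
  obtain ⟨F, hF, hxF⟩ := exists_component_mem (hS := hS) (H.edge_subset e he hxe) hxS
  refine ⟨F, ⟨(hC F).mpr hF, hF.subset_union_of_mem he hxe hxF⟩, ?_⟩
  rintro G ⟨hG, heG⟩
  refine ((hC G).mp hG).eq_of_mem empty_notMem_delete hF ?_ hxF
  exact (Finset.mem_union.mp (heG hxe)).resolve_right hxS

end Deletion

/-! ### Restricting a selection to an S-component -/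

section Restriction

variable {H : MultiHypergraph α} {u v : α} {hS : {u, v} ⊂ H.verts}
  {F : MultiHypergraph α} {P : Multiset (Finset α × Sym2 α)}

theorem IsEulerSelection.fst_mem (hP : H.IsEulerSelection P) {p : Finset α × Sym2 α} (hp : p ∈ P) :
    p.1 ∈ H.edges := by
  rw [← hP.map_fst]; exact Multiset.mem_map_of_mem _ hp

theorem IsEulerSelection.mem_pair (hP : H.IsEulerSelection P)
    (hodd : Odd (H.edges.count {u, v})) : (({u, v} : Finset α), s(u, v)) ∈ P := by
  refine Multiset.mem_of_mem_filter (p := fun p => p.1 ⊆ {u, v}) ?_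
  rw [filter_subset_pair_eq_replicate hP.not_isDiag hP.mem_edge, hP.map_fst]
  exact Multiset.mem_replicate.mpr ⟨hodd.pos.ne', rfl⟩

theorem IsEulerSelection.map_fst_restrict (hempty : ∅ ∉ H.edges) (hP : H.IsEulerSelection P)
    (S : Finset α) :
    (P.filter fun p => p.1 ⊆ F.verts ∪ S).map Prod.fst = (H.sComponent S F).edges := by
  have : (P.filter fun p => p.1 ⊆ F.verts ∪ S).map Prod.fst
      = (P.map Prod.fst).filter fun e => e ⊆ F.verts ∪ S := by
    rw [Multiset.filter_map]; rfl
  rw [this, hP.map_fst]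
  refine Multiset.filter_congr fun e he => ⟨fun h => ⟨h, ?_⟩, fun h => h.1⟩
  rintro rfl
  exact hempty he

theorem IsEulerSelection.reach_restrict (hP : H.IsEulerSelection P)
    (hodd : Odd (H.edges.count {u, v})) (hF : F.IsComponent (H.delete {u, v} hS)) {x y : α}
    (hx : x ∈ F.verts ∪ {u, v}) (hy : y ∈ F.verts ∪ {u, v}) :
    Relation.ReflTransGen (PairAdj (P.filter fun p => p.1 ⊆ F.verts ∪ {u, v})) x y := by
  set P' := P.filter fun p => p.1 ⊆ F.verts ∪ {u, v} with hP'
  have hu : u ∈ H.verts := hS.1 (by simp)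
  have huv : PairAdj P' v u := by
    refine ⟨{u, v}, Multiset.mem_filter.mpr ⟨?_, Finset.subset_union_right⟩⟩
    rw [Sym2.eq_swap]
    exact hP.mem_pair hodd
  -- A path from `F` stays in the S-component until it meets {u, v}; there the rest of it is
  -- replaced by the pair uv.
  have key : ∀ x, Relation.ReflTransGen (PairAdj P) x u → x ∈ F.verts ∪ {u, v} →
      Relation.ReflTransGen (PairAdj P') x u := by
    intro x h
    induction h using Relation.ReflTransGen.head_induction_on with
    | refl => exact fun _ => .refl
    | @head a c hac _ ih =>
      intro ha
      rcases Finset.mem_union.mp ha with haF | haS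
      · obtain ⟨e, he⟩ := hac
        have hae : a ∈ e := hP.mem_edge _ he a (by simp)
        have hce : c ∈ e := hP.mem_edge _ he c (by simp)
        have hsub := hF.subset_union_of_mem (hP.fst_mem he) hae haF
        exact (ih (hsub hce)).head ⟨e, Multiset.mem_filter.mpr ⟨he, hsub⟩⟩
      · simp only [Finset.mem_insert, Finset.mem_singleton] at haS
        rcases haS with rfl | rfl
        · exact .refl
        · exact .single huv
  have key' : ∀ x ∈ F.verts ∪ {u, v}, Relation.ReflTransGen (PairAdj P') x u := fun x hx =>
    key x (hP.reach x (hF.union_subset hx) u hu) hx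
  exact (key' x hx).trans (PairAdj.reach_symm (key' y hy))

/-- At a vertex of `F` no chosen pair is lost; at a vertex outside the S-component none is kept. -/
theorem IsEulerSelection.parity_restrict (hP : H.IsEulerSelection P)
    (hF : F.IsComponent (H.delete {u, v} hS)) {x : α} (hx : x ∉ ({u, v} : Finset α)) :
    parity x (P.filter fun p => p.1 ⊆ F.verts ∪ {u, v}) = 0 := by
  by_cases hxF : x ∈ F.verts
  · have h := parity_filter_add x P fun p => p.1 ⊆ F.verts ∪ {u, v}
    rw [hP.parity_eq, parity_eq_zero_of_forall (M := P.filter fun p => ¬ _), add_zero] at h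
    · exact h
    · intro p hp hxp
      obtain ⟨hp, hnot⟩ := Multiset.mem_filter.mp hp
      exact hnot (hF.subset_union_of_mem (hP.fst_mem hp) (hP.mem_edge p hp x hxp) hxF)
  · refine parity_eq_zero_of_forall fun p hp hxp => ?_
    obtain ⟨hp, hsub⟩ := Multiset.mem_filter.mp hp
    exact (Finset.mem_union.mp (hsub (hP.mem_edge p hp x hxp))).elim hxF hx

/-- By the handshake lemma the degrees sum to zero modulo two, and only u and v can contribute. -/
theorem IsEulerSelection.parity_restrict_eq (hP : H.IsEulerSelection P) (huv : u ≠ v)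
    (hF : F.IsComponent (H.delete {u, v} hS)) :
    parity v (P.filter fun p => p.1 ⊆ F.verts ∪ {u, v}) =
      parity u (P.filter fun p => p.1 ⊆ F.verts ∪ {u, v}) := by
  have h := sum_parity_eq_zero (F.verts ∪ {u, v}) (P.filter fun p => p.1 ⊆ F.verts ∪ {u, v})
    (fun p hp => by
      obtain ⟨hp, hsub⟩ := Multiset.mem_filter.mp hp
      exact ⟨hP.not_isDiag p hp, fun x hx => hsub (hP.mem_edge p hp x hx)⟩)
  rw [← Finset.sum_subset Finset.subset_union_right
    (fun x _ hx => hP.parity_restrict hF hx), Finset.sum_pair huv] at h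
  generalize parity u _ = a at h ⊢
  generalize parity v _ = b at h ⊢
  revert a b
  decide

theorem IsEulerSelection.sComponent (hempty : ∅ ∉ H.edges) (hP : H.IsEulerSelection P)
    (huv : u ≠ v) (hodd : Odd (H.edges.count {u, v})) (hF : F.IsComponent (H.delete {u, v} hS))
    (h0 : parity u (P.filter fun p => p.1 ⊆ F.verts ∪ {u, v}) = 0) :
    (H.sComponent {u, v} F).IsEulerSelection (P.filter fun p => p.1 ⊆ F.verts ∪ {u, v}) where
  map_fst := hP.map_fst_restrict hempty _
  not_isDiag p hp := hP.not_isDiag p (Multiset.mem_of_mem_filter hp)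
  mem_edge p hp := hP.mem_edge p (Multiset.mem_of_mem_filter hp)
  parity_eq x := by
    by_cases hx : x ∈ ({u, v} : Finset α)
    · simp only [Finset.mem_insert, Finset.mem_singleton] at hx
      rcases hx with rfl | rfl
      · exact h0
      · rw [hP.parity_restrict_eq huv hF, h0]
    · exact hP.parity_restrict hF hx
  reach x hx y hy := hP.reach_restrict hodd hF hx hy

theorem IsEulerSelection.sStarComponent (hempty : ∅ ∉ H.edges) (hP : H.IsEulerSelection P)
    (huv : u ≠ v) (hodd : Odd (H.edges.count {u, v})) (hF : F.IsComponent (H.delete {u, v} hS))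
    (h1 : parity u (P.filter fun p => p.1 ⊆ F.verts ∪ {u, v}) = 1) :
    (H.sStarComponent {u, v} F).IsEulerSelection
      (({u, v}, s(u, v)) ::ₘ P.filter fun p => p.1 ⊆ F.verts ∪ {u, v}) where
  map_fst := by
    rw [Multiset.map_cons, hP.map_fst_restrict hempty]
    simp [MultiHypergraph.sStarComponent, Finset.card_pair huv, ← Multiset.singleton_add, add_comm]
  not_isDiag p hp := by
    rcases Multiset.mem_cons.mp hp with rfl | hp
    · simpa using huv
    · exact hP.not_isDiag p (Multiset.mem_of_mem_filter hp)
  mem_edge p hp := by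
    rcases Multiset.mem_cons.mp hp with rfl | hp
    · simp
    · exact hP.mem_edge p (Multiset.mem_of_mem_filter hp)
  parity_eq x := by
    have two : (1 : ZMod 2) + 1 = 0 := by decide
    rw [parity_cons]
    by_cases hx : x ∈ ({u, v} : Finset α)
    · simp only [Finset.mem_insert, Finset.mem_singleton] at hx
      rcases hx with rfl | rfl
      · rw [h1, if_pos (by simp), two]
      · rw [hP.parity_restrict_eq huv hF, h1, if_pos (by simp), two]
    · rw [hP.parity_restrict hF hx, if_neg (by simpa using hx), add_zero]
  reach x hx y hy := Relation.ReflTransGen.mono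
    (fun _ _ ⟨l, hl⟩ => ⟨l, Multiset.mem_cons_of_mem hl⟩) _ _ (hP.reach_restrict hodd hF hx hy)

theorem IsEulerSelection.odd_card (hP : H.IsEulerSelection P)
    (hodd : Odd (H.edges.count {u, v})) {C : Finset (MultiHypergraph α)}
    (hC : ∀ F, F ∈ C ↔ F.IsComponent (H.delete {u, v} hS)) :
    Odd (C.filter fun F => parity u (P.filter fun p => p.1 ⊆ F.verts ∪ {u, v}) = 0).card := by
  have two : (1 : ZMod 2) + 1 = 0 := by decide
  have hm : ((H.edges.count {u, v} : ℕ) : ZMod 2) = 1 := ZMod.natCast_eq_one_iff_odd.mpr hodd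
  have hS1 : parity u (P.filter fun p => p.1 ⊆ {u, v}) = 1 := by
    rw [filter_subset_pair_eq_replicate hP.not_isDiag hP.mem_edge, parity_replicate, hP.map_fst, hm]
    simp
  have hpart := sum_filter_eq_of_existsUnique (P.filter fun p => ¬ p.1 ⊆ {u, v}) C
    (fun F p => p.1 ⊆ F.verts ∪ {u, v}) (fun p hp => by
      obtain ⟨hp, hnot⟩ := Multiset.mem_filter.mp hp
      exact existsUnique_component hC (hP.fst_mem hp) hnot)
  -- The pairs from edges inside {u, v} contribute 1 to each restriction, so removing them flips the
  -- parity at u.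
  have hloc : ∀ F ∈ C, parity u ((P.filter fun p => ¬ p.1 ⊆ {u, v}).filter
      fun p => p.1 ⊆ F.verts ∪ {u, v})
        = 1 + parity u (P.filter fun p => p.1 ⊆ F.verts ∪ {u, v}) := by
    intro F _
    have h := parity_filter_add u (P.filter fun p => p.1 ⊆ F.verts ∪ {u, v})
      fun p => p.1 ⊆ {u, v}
    have hsame : ((P.filter fun p => p.1 ⊆ F.verts ∪ {u, v}).filter fun p => p.1 ⊆ {u, v})
        = P.filter fun p => p.1 ⊆ {u, v} := by
      rw [Multiset.filter_filter]
      exact Multiset.filter_congr fun p _ =>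
        ⟨fun h => h.1, fun h => ⟨h, h.trans Finset.subset_union_right⟩⟩
    rw [hsame, hS1, Multiset.filter_comm] at h
    rw [← h, ← add_assoc, two, zero_add]
  have htot := parity_filter_add u P fun p => p.1 ⊆ {u, v}
  rw [hP.parity_eq, hS1, ← hpart, parity_sum, Finset.sum_congr rfl hloc] at htot
  -- In `ZMod 2`, 1 + a is the indicator of a = 0, so the sum counts the set in question.
  have hind : ∀ F ∈ C, (1 : ZMod 2) + parity u (P.filter fun p => p.1 ⊆ F.verts ∪ {u, v}) =
      if parity u (P.filter fun p => p.1 ⊆ F.verts ∪ {u, v}) = 0 then 1 else 0 := by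
    intro F _
    generalize parity u _ = a
    revert a
    decide
  rw [Finset.sum_congr rfl hind, Finset.sum_boole] at htot
  rw [← ZMod.natCast_eq_one_iff_odd]
  generalize ((Finset.card _ : ℕ) : ZMod 2) = a at htot ⊢
  revert a
  decide

end Restriction

/-! ### Gluing selections of the components -/

section Gluing

variable {H : MultiHypergraph α} {u v : α} {hS : {u, v} ⊂ H.verts} {F : MultiHypergraph α}

/-- The part inside `F` of an Euler selection of an `S`-component or of an `S*`-component, where
`n` is the number of additional copies of `S = {u, v}`. -/
structure IsPartialSelection (H : MultiHypergraph α) (u v : α) (F : MultiHypergraph α) (n : ℕ)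
    (P : Multiset (Finset α × Sym2 α)) : Prop where
  map_fst : P.map Prod.fst = H.edges.filter fun e => ¬ e ⊆ {u, v} ∧ e ⊆ F.verts ∪ {u, v}
  not_isDiag : ∀ p ∈ P, ¬ p.2.IsDiag
  mem_edge : ∀ p ∈ P, ∀ x ∈ p.2, x ∈ p.1
  parity_eq : ∀ x, parity x P = (1 + n) * if x ∈ s(u, v) then 1 else 0
  reach : ∀ x ∈ F.verts ∪ {u, v}, ∀ y ∈ F.verts ∪ {u, v},
    Relation.ReflTransGen (PairAdj (({u, v}, s(u, v)) ::ₘ P)) x y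

/-- Exactly m + n pairs uv are discarded, with m odd, which leaves parity 1 + n at u and v. A single
uv restores connectivity, as the discarded pairs are all parallel. -/
theorem IsEulerSelection.isPartialSelection {G : MultiHypergraph α} {n : ℕ}
    (hodd : Odd (H.edges.count {u, v}))
    (hverts : G.verts = F.verts ∪ {u, v})
    (hedges : G.edges = (H.sComponent {u, v} F).edges + Multiset.replicate n {u, v})
    {P : Multiset (Finset α × Sym2 α)} (hP : G.IsEulerSelection P) :
    H.IsPartialSelection u v F n (P.filter fun p => ¬ p.1 ⊆ {u, v}) := by
  have hne : ({u, v} : Finset α) ≠ ∅ := (Finset.insert_nonempty _ _).ne_empty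
  have hfilter : P.filter (fun p => p.1 ⊆ {u, v})
      = Multiset.replicate (H.edges.count {u, v} + n) ({u, v}, s(u, v)) := by
    rw [filter_subset_pair_eq_replicate hP.not_isDiag hP.mem_edge, hP.map_fst, hedges,
      Multiset.count_add, Multiset.count_replicate_self, MultiHypergraph.sComponent,
      Multiset.count_filter_of_pos ⟨Finset.subset_union_right, hne⟩]
  have hm : ((H.edges.count {u, v} : ℕ) : ZMod 2) = 1 := ZMod.natCast_eq_one_iff_odd.mpr hodd
  refine ⟨?_, fun p hp => hP.not_isDiag p (Multiset.mem_of_mem_filter hp),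
    fun p hp => hP.mem_edge p (Multiset.mem_of_mem_filter hp), fun x => ?_, fun x hx y hy => ?_⟩
  · have : (P.filter fun p => ¬ p.1 ⊆ {u, v}).map Prod.fst
        = (P.map Prod.fst).filter fun e => ¬ e ⊆ {u, v} := by
      rw [Multiset.filter_map]; rfl
    rw [this, hP.map_fst, hedges, Multiset.filter_add,
      Multiset.filter_eq_nil (s := Multiset.replicate _ _) |>.mpr, add_zero,
      MultiHypergraph.sComponent, Multiset.filter_filter]
    · refine Multiset.filter_congr fun e _ => ⟨fun h => ⟨h.1, h.2.1⟩, fun h => ⟨h.1, h.2, ?_⟩⟩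
      rintro rfl
      exact h.1 (Finset.empty_subset _)
    · intro e he
      rw [Multiset.eq_of_mem_replicate he]
      simp
  · have h := parity_filter_add x P fun p => p.1 ⊆ {u, v}
    rw [hP.parity_eq, hfilter, parity_replicate, Nat.cast_add, hm] at h
    simp only at h
    generalize ((1 : ZMod 2) + n) * _ = a at h ⊢
    generalize parity x _ = b at h ⊢
    revert a b
    decide
  · rw [← hverts] at hx hy
    refine Relation.ReflTransGen.mono (fun a b ⟨l, hl⟩ => ⟨l, ?_⟩) _ _ (hP.reach x hx y hy)
    by_cases hs : l ⊆ {u, v}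
    · have : (l, s(a, b)) ∈ P.filter fun p => p.1 ⊆ {u, v} := Multiset.mem_filter.mpr ⟨hl, hs⟩
      rw [hfilter] at this
      rw [Multiset.eq_of_mem_replicate this]
      exact Multiset.mem_cons_self _ _
    · exact Multiset.mem_cons_of_mem (Multiset.mem_filter.mpr ⟨hl, hs⟩)

theorem isEulerSelection_glue (huv : u ≠ v)
    (hodd : Odd (H.edges.count {u, v})) {C J : Finset (MultiHypergraph α)}
    [∀ F, Decidable (F ∈ J)]
    (hC : ∀ F, F ∈ C ↔ F.IsComponent (H.delete {u, v} hS)) (hJC : J ⊆ C) (hJ : Odd J.card)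
    {P : MultiHypergraph α → Multiset (Finset α × Sym2 α)}
    (hP : ∀ F ∈ C, H.IsPartialSelection u v F (if F ∈ J then 0 else 1) (P F))
    (hsing : ∀ e ∈ H.edges, e ⊆ {u, v} → e = {u, v}) :
    H.IsEulerSelection
      (Multiset.replicate (H.edges.count {u, v}) ({u, v}, s(u, v)) + ∑ F ∈ C, P F) := by
  have hmem : ∀ p ∈ Multiset.replicate (H.edges.count {u, v}) (({u, v} : Finset α), s(u, v))
      + ∑ F ∈ C, P F, p = ({u, v}, s(u, v)) ∨ ∃ F ∈ C, p ∈ P F := by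
    intro p hp
    rcases Multiset.mem_add.mp hp with hp | hp
    · exact .inl (Multiset.eq_of_mem_replicate hp)
    · exact .inr (Multiset.mem_sum.mp hp)
  refine ⟨?_, ?_, ?_, ?_, ?_⟩
  · have hsum : (∑ F ∈ C, P F).map Prod.fst = H.edges.filter fun e => ¬ e ⊆ {u, v} := by
      rw [← Multiset.coe_mapAddMonoidHom, map_sum]
      simp only [Multiset.coe_mapAddMonoidHom]
      rw [Finset.sum_congr rfl fun F hF => (hP F hF).map_fst]
      rw [← sum_filter_eq_of_existsUnique (H.edges.filter fun e => ¬ e ⊆ {u, v}) C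
        (fun F e => e ⊆ F.verts ∪ {u, v})]
      · refine Finset.sum_congr rfl fun F _ => ?_
        rw [Multiset.filter_filter]
        exact Multiset.filter_congr fun _ _ => and_comm
      · intro e he
        obtain ⟨he, hnot⟩ := Multiset.mem_filter.mp he
        exact existsUnique_component hC he hnot
    rw [Multiset.map_add, hsum, Multiset.map_replicate]
    conv_rhs => rw [← Multiset.filter_add_not (fun e => e ⊆ {u, v}) H.edges]
    congr 1
    rw [← Multiset.filter_eq' H.edges]
    exact Multiset.filter_congr fun e he => ⟨fun h => h ▸ subset_rfl, hsing e he⟩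
  · intro p hp
    rcases hmem p hp with rfl | ⟨F, hF, hp⟩
    · simpa using huv
    · exact (hP F hF).not_isDiag p hp
  · intro p hp
    rcases hmem p hp with rfl | ⟨F, hF, hp⟩
    · simp
    · exact (hP F hF).mem_edge p hp
  · intro x
    have hm : ((H.edges.count {u, v} : ℕ) : ZMod 2) = 1 := ZMod.natCast_eq_one_iff_odd.mpr hodd
    have hind : ∀ F ∈ C, parity x (P F)
        = (if F ∈ J then 1 else 0) * if x ∈ s(u, v) then 1 else 0 := by
      intro F hF
      rw [(hP F hF).parity_eq]
      congr 1
      split_ifs <;> decide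
    have hJ1 : ((J.card : ℕ) : ZMod 2) = 1 := ZMod.natCast_eq_one_iff_odd.mpr hJ
    have hfil : C.filter (· ∈ J) = J := by
      ext F; simpa using fun h => hJC h
    rw [parity_add, parity_replicate, parity_sum, Finset.sum_congr rfl hind, hm, ← Finset.sum_mul,
      Finset.sum_boole, hfil, hJ1, ← add_mul, show (1 : ZMod 2) + 1 = 0 by decide, zero_mul]
  · have hle : ∀ F ∈ C, ∀ x ∈ F.verts ∪ {u, v}, ∀ y ∈ F.verts ∪ {u, v},
        Relation.ReflTransGen (PairAdj
          (Multiset.replicate (H.edges.count {u, v}) ({u, v}, s(u, v)) + ∑ F ∈ C, P F)) x y := by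
      intro F hF x hx y hy
      refine Relation.ReflTransGen.mono (fun a b ⟨l, hl⟩ => ⟨l, ?_⟩) _ _ ((hP F hF).reach x hx y hy)
      rcases Multiset.mem_cons.mp hl with h | h
      · rw [h]
        exact Multiset.mem_add.mpr (.inl (Multiset.mem_replicate.mpr ⟨hodd.pos.ne', rfl⟩))
      · exact Multiset.mem_add.mpr (.inr (Multiset.mem_sum.mpr ⟨F, hF, h⟩))
    -- Some component must exist, as the path between u and v is taken from its S-component.
    have hCne : C.Nonempty := (Finset.card_pos.mp hJ.pos).mono hJC
    have hto : ∀ x ∈ H.verts, Relation.ReflTransGen (PairAdj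
          (Multiset.replicate (H.edges.count {u, v}) ({u, v}, s(u, v)) + ∑ F ∈ C, P F)) x u := by
      intro x hx
      by_cases hxS : x ∈ ({u, v} : Finset α)
      · obtain ⟨F, hF⟩ := hCne
        exact hle F hF x (Finset.mem_union_right _ hxS) u (by simp)
      · obtain ⟨F, hF, hxF⟩ := exists_component_mem (hS := hS) hx hxS
        exact hle F ((hC F).mpr hF) x (Finset.mem_union_left _ hxF) u (by simp)
    exact fun x hx y hy => (hto x hx).trans (PairAdj.reach_symm (hto y hy))

theorem IsEulerSelection.eq_pair_of_subset {G : MultiHypergraph α}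
    {P : Multiset (Finset α × Sym2 α)} (hP : G.IsEulerSelection P) {e : Finset α}
    (he : e ∈ G.edges) (hsub : e ⊆ {u, v}) : e = {u, v} := by
  rw [← hP.map_fst] at he
  obtain ⟨p, hp, rfl⟩ := Multiset.mem_map.mp he
  have h : p ∈ P.filter fun p => p.1 ⊆ {u, v} := Multiset.mem_filter.mpr ⟨hp, hsub⟩
  rw [filter_subset_pair_eq_replicate hP.not_isDiag hP.mem_edge] at h
  rw [Multiset.eq_of_mem_replicate h]

end Gluing

end MultiHypergraph

/-! ### The theorem -/

theorem theorem3p15 {α : Type*} [DecidableEq α] (H : MultiHypergraph α) (hempty : ∅ ∉ H.edges)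
    (S : Finset α) (hcard : S.card = 2) (hcut : H.IsVertexCut S)
    (hodd : Odd (H.edges.count S)) :
    H.HasSpanningEulerTour ↔
      ∃ J : Finset (MultiHypergraph α),
        (∀ F ∈ J, F.IsComponent (H.delete S hcut.ssubset)) ∧ Odd J.card ∧
        (∀ F ∈ J, (H.sComponent S F).HasSpanningEulerTour) ∧
        (∀ F : MultiHypergraph α, F.IsComponent (H.delete S hcut.ssubset) → F ∉ J →
          (H.sStarComponent S F).HasSpanningEulerTour) := by
  classical
  obtain ⟨u, v, huv, rfl⟩ := Finset.card_eq_two.mp hcard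
  have hnontriv : ∀ V : Finset α, {u, v} ⊆ V → V.Nontrivial := fun V hV =>
    ⟨u, hV (by simp), v, hV (by simp), huv⟩
  obtain ⟨C, hC⟩ := MultiHypergraph.exists_finset_components (H := H.delete {u, v} hcut.ssubset)
    MultiHypergraph.empty_notMem_delete
  constructor
  · intro h
    obtain ⟨P, hP⟩ := h.exists_selection
    refine ⟨C.filter fun F =>
        MultiHypergraph.parity u (P.filter fun p => p.1 ⊆ F.verts ∪ {u, v}) = 0,
      fun F hF => (hC F).mp (Finset.mem_filter.mp hF).1, hP.odd_card hodd hC, fun F hF => ?_,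
      fun F hF hFJ => ?_⟩
    · obtain ⟨hFC, h0⟩ := Finset.mem_filter.mp hF
      exact (hP.sComponent hempty huv hodd ((hC F).mp hFC) h0).hasSpanningEulerTour
        (hnontriv _ Finset.subset_union_right)
    · have h1 : MultiHypergraph.parity u (P.filter fun p => p.1 ⊆ F.verts ∪ {u, v}) = 1 := by
        have h0 : MultiHypergraph.parity u (P.filter fun p => p.1 ⊆ F.verts ∪ {u, v}) ≠ 0 := fun h0 =>
          hFJ (Finset.mem_filter.mpr ⟨(hC F).mpr hF, h0⟩)
        generalize MultiHypergraph.parity u _ = a at h0 ⊢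
        revert a
        decide
      exact (hP.sStarComponent hempty huv hodd hF h1).hasSpanningEulerTour
        (hnontriv _ Finset.subset_union_right)
  · rintro ⟨J, hJC, hJ, hJtour, hJstar⟩
    -- Membership in `C` is placed under the existential so that `choose` gives a function on all
    -- hypergraphs; outside `C` its value is irrelevant.
    have hpart : ∀ F, ∃ P, F ∈ C →
        H.IsPartialSelection u v F (if F ∈ J then 0 else 1) P := by
      intro F
      by_cases hF : F ∈ C
      · by_cases hFJ : F ∈ J
        · obtain ⟨P, hP⟩ := (hJtour F hFJ).exists_selection
          refine ⟨P.filter fun p => ¬ p.1 ⊆ {u, v}, fun _ => ?_⟩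
          rw [if_pos hFJ]
          exact hP.isPartialSelection hodd rfl (by simp)
        · obtain ⟨P, hP⟩ := (hJstar F ((hC F).mp hF) hFJ).exists_selection
          refine ⟨P.filter fun p => ¬ p.1 ⊆ {u, v}, fun _ => ?_⟩
          rw [if_neg hFJ]
          exact hP.isPartialSelection hodd rfl (by
            simp [MultiHypergraph.sStarComponent, Finset.card_pair huv])
      · exact ⟨0, fun h => (hF h).elim⟩
    choose P hP using hpart
    -- Singleton edges inside {u, v} belong to every S-component; a tour of one with index in the
    -- non-empty set `J` rules them out.
    have hsing : ∀ e ∈ H.edges, e ⊆ {u, v} → e = {u, v} := by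
      intro e he hsub
      obtain ⟨F, hF⟩ := Finset.card_pos.mp hJ.pos
      obtain ⟨Q, hQ⟩ := (hJtour F hF).exists_selection
      refine hQ.eq_pair_of_subset (Multiset.mem_filter.mpr
        ⟨he, hsub.trans Finset.subset_union_right, ?_⟩) hsub
      rintro rfl
      exact hempty he
    exact (MultiHypergraph.isEulerSelection_glue huv hodd hC (fun F hF => (hC F).mpr (hJC F hF)) hJ hP
      hsing).hasSpanningEulerTour (hnontriv _ hcut.ssubset.1)
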